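/- Let $\mathbb F$ be a field of characteristic different from $2$ and let $n\ge 1$ be an integer. An $n$-SLTM is a strictly lower triangular $n\times n$ matrix $T=[t_{ij}]$ with entries in $\mathbb F$. Its nil graded algebra $\mathcal A(T)$ is the commutative unital $\mathbb F$-algebra with generators $X_1,\dots,X_n$ and relations $$X_1^2=0,\qquad X_i^2=\sum_{j<i}t_{ij}X_jX_i\quad(2\le i\le n),$$ graded by $\deg X_i=2$ for all $i$. For $n$-SLTMs $T,S$ write $T\sim S$ if there is a degree-preserving isomorphism of $\mathbb F$-algebras $\mathcal A(T)\to\mathcal A(S)$, and let $N_n\in\{0,1,2,\dots\}\cup\{\infty\}$ be the number of equivalence classes of $\sim$ on the set of all $n$-SLTMs. Then $$N_n\ \ge\ C_{n-1},$$ where $C_m=\frac1{m+1}\binom{2m}{m}$ is the $m$-th Catalan number. -/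

import Mathlib

/-- An `n`-SLTM over `F`: a strictly lower triangular `n × n` matrix with entries in `F`. -/
def SLTM (F : Type*) [Field F] (n : ℕ) : Type _ :=
  {T : Matrix (Fin n) (Fin n) F // ∀ i j : Fin n, i ≤ j → T i j = 0}

namespace SLTM

variable {F : Type*} [Field F] {n : ℕ}

/-- The polynomial `X_i ^ 2 - ∑_{j < i} t_{ij} X_j X_i`
(which is `X_i ^ 2` when `i` is the smallest index). -/
noncomputable def relator (T : SLTM F n) (i : Fin n) : MvPolynomial (Fin n) F :=
  MvPolynomial.X i ^ 2 -
    ∑ j ∈ Finset.univ.filter (fun j : Fin n => j < i),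
      MvPolynomial.C (T.1 i j) * MvPolynomial.X j * MvPolynomial.X i

/-- The nil graded algebra `A(T)`: the commutative unital `F`-algebra with generators
`X_1, …, X_n` and relations `X_i ^ 2 = ∑_{j < i} t_{ij} X_j X_i`. -/
abbrev NilAlgebra (T : SLTM F n) : Type _ :=
  MvPolynomial (Fin n) F ⧸ Ideal.span (Set.range T.relator)

/-- The homogeneous component of degree `d` of `A(T)` for the grading with `deg X_i = 2`:
the classes of the weighted homogeneous polynomials of degree `d`, all weights being `2`. -/
noncomputable def component (T : SLTM F n) (d : ℕ) : Submodule F T.NilAlgebra :=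
  (MvPolynomial.weightedHomogeneousSubmodule F (fun _ : Fin n => (2 : ℕ)) d).map
    (Ideal.Quotient.mkₐ F (Ideal.span (Set.range T.relator))).toLinearMap

/-- `T ∼ S`: there is a degree preserving isomorphism of `F`-algebras `A(T) ≃ A(S)`. -/
def Equivalent (T S : SLTM F n) : Prop :=
  ∃ e : T.NilAlgebra ≃ₐ[F] S.NilAlgebra,
    ∀ (d : ℕ) (x : T.NilAlgebra), e x ∈ S.component d ↔ x ∈ T.component d

theorem equivalent_refl (T : SLTM F n) : T.Equivalent T :=
  ⟨AlgEquiv.refl, fun _ _ => Iff.rfl⟩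

theorem Equivalent.symm {T S : SLTM F n} (h : T.Equivalent S) : S.Equivalent T := by
  obtain ⟨e, he⟩ := h
  refine ⟨e.symm, fun d y => ?_⟩
  rw [← he d (e.symm y), AlgEquiv.apply_symm_apply]

theorem Equivalent.trans {T S U : SLTM F n} (h₁ : T.Equivalent S) (h₂ : S.Equivalent U) :
    T.Equivalent U := by
  obtain ⟨e, he⟩ := h₁
  obtain ⟨f, hf⟩ := h₂
  exact ⟨e.trans f, fun d x => (hf d (e x)).trans (he d x)⟩

/-- The equivalence relation `∼` on the set of all `n`-SLTM. -/
def isoSetoid (F : Type*) [Field F] (n : ℕ) : Setoid (SLTM F n) where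
  r := Equivalent
  iseqv := ⟨equivalent_refl, Equivalent.symm, Equivalent.trans⟩

/-- `N_n`: the number (possibly `∞`) of classes of `n`-SLTM under `∼`. -/
noncomputable def numClasses (F : Type*) [Field F] (n : ℕ) : ℕ∞ :=
  ENat.card (Quotient (isoSetoid F n))

end SLTM

/-! For strictly lower triangular `s` put `T = 2 s (1 + s)⁻¹` and `X = (1 + s) Y`. Then `X_j = Y_j +
L_j` with `L_j = ∑ i, s_{ji} Y_i`, and the relation `X_j ^ 2 = 2 L_j X_j` becomes `Y_j ^ 2 = L_j ^
2`. Take `L_j = Y_0 + ⋯ + Y_{f j - 1}` for a monotone `f` with `f j ≤ j`, and `f j ≥ 1` for `j > 0`;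
Dyck words of semilength `n - 1` give `C_{n-1}` such `f`.

The graded algebra recovers `f`: among degree 2 elements whose square vanishes modulo a chain of `m`
successive degree 2 elements, each of square zero modulo the earlier ones, the largest independent
family has `#{j | f j ≤ m + 1}` members. The chain `Y_0, …, Y_{m-1}` attains this
(`hasChain_ofStaircase`). The bound (`le_of_hasChain`) holds because every chain lies in the span of
at most `m` variables whose own relations have become redundant (`exists_adapted_support`). Modulo
these, characteristic not 2 forces a form of square zero to be a multiple of a single variable
(`SqRel.support`). -/

open Matrix

namespace SLTM

/-! ### Squares of linear forms modulo the relations -/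

section QuadraticForms

variable {F : Type*} [Field F] {n : ℕ}

/-- The quadratic form `y_j ^ 2 - (∑ i, s_{ji} y_i) ^ 2`. -/
def diffSq (s : Matrix (Fin n) (Fin n) F) (j : Fin n) (y : Fin n → F) : F :=
  y j ^ 2 - (s j ⬝ᵥ y) ^ 2

/-- On the coordinate subspace `y_K = 0`, the square of the linear form `a` is a combination of
the forms `diffSq s j` with `j ∉ K`. -/
def SqRel (s : Matrix (Fin n) (Fin n) F) (K : Finset (Fin n)) (a : Fin n → F) : Prop :=
  ∃ c : Fin n → F, (∀ k ∈ K, c k = 0) ∧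
    ∀ y : Fin n → F, (∀ k ∈ K, y k = 0) → (a ⬝ᵥ y) ^ 2 = ∑ j, c j * diffSq s j y

theorem diffSq_add_single {s : Matrix (Fin n) (Fin n) F} {j k : Fin n} (hjk : j ≠ k)
    (hs : s j k = 0) (y : Fin n → F) : diffSq s j (y + Pi.single k 1) = diffSq s j y := by
  simp [diffSq, dotProduct_add, hs, hjk]

theorem diffSq_add_single_self {s : Matrix (Fin n) (Fin n) F} {k : Fin n}
    (hs : s k k = 0) {y : Fin n → F} (hy : y k = 0) :
    diffSq s k (y + Pi.single k 1) = diffSq s k y + 1 := by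
  simp [diffSq, dotProduct_add, hs, hy]
  ring

/-- If `t` were the largest index with `c t ≠ 0`, passing from `0` to the `t`-th basis vector would
change the right side by `c t` and leave the left side at `0`. -/
theorem coeff_eq_zero_of_sqRel {s : Matrix (Fin n) (Fin n) F} (hs : ∀ i j, i ≤ j → s i j = 0)
    {K : Finset (Fin n)} {a c : Fin n → F} (hc : ∀ k ∈ K, c k = 0)
    (h : ∀ y : Fin n → F, (∀ k ∈ K, y k = 0) → (a ⬝ᵥ y) ^ 2 = ∑ j, c j * diffSq s j y)
    {k : Fin n} (ha : ∀ i ∉ K, k ≤ i → a i = 0) : ∀ i, k ≤ i → c i = 0 := by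
  classical
  by_contra! hcon
  obtain ⟨t₀, ht₀, hct₀⟩ := hcon
  obtain ⟨t, ht, hmax⟩ := (Finset.univ.filter fun i => k ≤ i ∧ c i ≠ 0).exists_max_image id
    ⟨t₀, by simp [ht₀, hct₀]⟩
  simp only [Finset.mem_filter, Finset.mem_univ, true_and, id] at ht hmax
  have htK : t ∉ K := fun hK => ht.2 (hc t hK)
  have h1 := h (0 + Pi.single t 1) (fun i hi => by
    have : i ≠ t := by rintro rfl; exact htK hi
    simp [this])
  have h2 := h 0 (by simp)
  rw [Finset.sum_eq_add_sum_sdiff_singleton_of_mem (Finset.mem_univ t)] at h1 h2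
  rw [Finset.sum_congr rfl (g := fun j => c j * diffSq s j 0)] at h1
  · rw [diffSq_add_single_self (hs t t le_rfl) rfl] at h1
    simp [ha t htK ht.1] at h1 h2
    rw [mul_add, add_assoc, add_comm _ (_ : F), add_assoc, add_comm _ (c t * _), ← h2] at h1
    simp at h1
    exact ht.2 h1.symm
  · intro j hj
    simp only [Finset.mem_sdiff, Finset.mem_univ, Finset.mem_singleton, true_and] at hj
    rcases lt_or_gt_of_ne hj with hlt | hgt
    · rw [diffSq_add_single hj (hs _ _ hlt.le)]
    · have : c j = 0 := by
        by_contra hne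
        exact absurd (hmax j ⟨ht.1.trans hgt.le, hne⟩) (not_le.mpr hgt)
      simp [this]

/-- A linear form whose square vanishes in the quotient by the variables in `K` involves at most
one variable outside `K`, and the square of the associated `s`-row vanishes as well. -/
theorem SqRel.support (h2 : (2 : F) ≠ 0) {s : Matrix (Fin n) (Fin n) F}
    (hs : ∀ i j, i ≤ j → s i j = 0) {K : Finset (Fin n)} {a : Fin n → F} (h : SqRel s K a) :
    (∀ i ∉ K, a i = 0) ∨ ∃ k ∉ K, (∀ i ∉ K, i ≠ k → a i = 0) ∧
      ∃ c : Fin n → F, (∀ j ∈ K, c j = 0) ∧ c k = 0 ∧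
        ∀ y : Fin n → F, (∀ j ∈ K, y j = 0) → (s k ⬝ᵥ y) ^ 2 = ∑ j, c j * diffSq s j y := by
  classical
  by_cases h0 : ∀ i ∉ K, a i = 0
  · exact Or.inl h0
  right
  push Not at h0
  obtain ⟨k₀, hk₀⟩ := h0
  obtain ⟨k, hk, hmax⟩ := (Finset.univ.filter fun i => i ∉ K ∧ a i ≠ 0).exists_max_image id
    ⟨k₀, by simp [hk₀.1, hk₀.2]⟩
  simp only [Finset.mem_filter, Finset.mem_univ, true_and, id] at hk hmax
  obtain ⟨hkK, hak⟩ := hk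
  have ha_top : ∀ i ∉ K, k < i → a i = 0 := fun i hi hlt => by
    by_contra hne
    exact absurd (hmax i ⟨hi, hne⟩) (not_le.mpr hlt)
  obtain ⟨c, hc, hrel⟩ := h
  have hc_top : ∀ i, k < i → c i = 0 := fun i hi =>
    coeff_eq_zero_of_sqRel hs hc hrel (k := i)
      (fun j hj hij => ha_top j hj (hi.trans_le hij)) i le_rfl
  -- Compare the relation at `y` and at `y + e_k`: forms with `j < k` do not involve `y_k`, those
  -- with `j > k` have coefficient zero.
  have key : ∀ y : Fin n → F, (∀ j ∈ K, y j = 0) → y k = 0 →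
      2 * (a ⬝ᵥ y) * a k + a k ^ 2 = c k := by
    intro y hyK hyk
    have h1 := hrel (y + Pi.single k 1) (fun i hi => by
      have : i ≠ k := by rintro rfl; exact hkK hi
      simp [this, hyK i hi])
    have h2 := hrel y hyK
    rw [Finset.sum_eq_add_sum_sdiff_singleton_of_mem (Finset.mem_univ k)] at h1 h2
    rw [Finset.sum_congr rfl (g := fun j => c j * diffSq s j y)] at h1
    · rw [diffSq_add_single_self (hs k k le_rfl) hyk] at h1
      simp only [dotProduct_add, dotProduct_single, mul_one] at h1
      linear_combination h1 - h2
    · intro j hj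
      simp only [Finset.mem_sdiff, Finset.mem_univ, Finset.mem_singleton, true_and] at hj
      rcases lt_or_gt_of_ne hj with hlt | hgt
      · rw [diffSq_add_single hj (hs _ _ hlt.le)]
      · simp [hc_top j hgt]
  have hck : a k ^ 2 = c k := by simpa using key 0 (by simp) rfl
  have hsupp : ∀ i ∉ K, i ≠ k → a i = 0 := by
    intro i hi hik
    -- Subtracting the value at `0` leaves `2 * a i * a k = 0`; this is where characteristic 2 is
    -- excluded.
    have h3 := key (Pi.single i 1) (fun j hj => by
      have : j ≠ i := by rintro rfl; exact hi hj
      simp [this]) (by simp [hik.symm])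
    rw [← hck] at h3
    simpa [h2, hak] using h3
  -- Since `c k = a k ^ 2`, the `y k ^ 2` terms cancel; solve for the square of row `k` and divide
  -- by `c k`.
  refine ⟨k, hkK, hsupp, fun j => if j = k then 0 else c j / c k, ?_, by simp, ?_⟩
  · intro j hj
    simp [hc j hj]
  · intro y hy
    have h4 := hrel y hy
    have h5 : a ⬝ᵥ y = a k * y k := by
      rw [dotProduct, Finset.sum_eq_single k]
      · intro i _ hik
        by_cases hiK : i ∈ K
        · simp [hy i hiK]
        · simp [hsupp i hiK hik]
      · simp
    have hck0 : c k ≠ 0 := hck ▸ pow_ne_zero 2 hak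
    rw [Finset.sum_eq_add_sum_sdiff_singleton_of_mem (Finset.mem_univ k)] at h4 ⊢
    rw [Finset.sum_congr rfl (g := fun j => (c k)⁻¹ * (c j * diffSq s j y)), ← Finset.mul_sum]
    · rw [h5, mul_pow, hck, diffSq] at h4
      simp only [if_true, zero_mul, zero_add]
      field_simp
      linear_combination h4
    · intro j hj
      simp only [Finset.mem_sdiff, Finset.mem_univ, Finset.mem_singleton, true_and] at hj
      simp only [hj, if_false]
      ring

/-- The relations indexed by `K` follow, on `y_K = 0`, from the relations outside `K`. -/
def Adapted (s : Matrix (Fin n) (Fin n) F) (K : Finset (Fin n)) : Prop :=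
  ∀ k ∈ K, SqRel s K (s k)

/-- For `k ∈ K`, `diffSq s k` restricts to `-(s k ⬝ᵥ y) ^ 2` on `y_K = 0`, which adaptedness
rewrites through indices outside `K`. -/
theorem Adapted.sqRel {s : Matrix (Fin n) (Fin n) F} {K : Finset (Fin n)} (hK : Adapted s K)
    {a c : Fin n → F}
    (h : ∀ y : Fin n → F, (∀ k ∈ K, y k = 0) → (a ⬝ᵥ y) ^ 2 = ∑ j, c j * diffSq s j y) :
    SqRel s K a := by
  choose! d hdK hd using hK
  refine ⟨fun j => (if j ∈ K then 0 else c j) - ∑ k ∈ K, c k * d k j, fun j hj => ?_,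
    fun y hy => ?_⟩
  · simp only [hj, if_true, zero_sub, neg_eq_zero]
    exact Finset.sum_eq_zero fun k hk => by rw [hdK k hk j hj, mul_zero]
  · have h1 : ∀ k ∈ K, c k * diffSq s k y = - ∑ j, c k * d k j * diffSq s j y := by
      intro k hk
      rw [diffSq, hy k hk, hd k hk y hy, zero_pow two_ne_zero, zero_sub, mul_neg, Finset.mul_sum]
      simp only [mul_assoc]
    rw [h y hy, ← Finset.sum_filter_add_sum_filter_not _ (fun j => j ∈ K)]
    simp only [sub_mul, Finset.sum_sub_distrib, Finset.sum_mul]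
    rw [Finset.sum_comm (s := Finset.univ) (t := K), Finset.filter_univ_mem,
      Finset.sum_congr rfl h1, Finset.sum_neg_distrib, Finset.sum_filter]
    simp only [ite_mul, zero_mul, ite_not]
    ring

theorem adapted_insert {s : Matrix (Fin n) (Fin n) F} {K : Finset (Fin n)} (hK : Adapted s K)
    {k : Fin n} {d : Fin n → F} (hdK : ∀ j ∈ K, d j = 0) (hdk : d k = 0)
    (hd : ∀ y : Fin n → F, (∀ j ∈ K, y j = 0) → (s k ⬝ᵥ y) ^ 2 = ∑ j, d j * diffSq s j y) :
    Adapted s (insert k K) := by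
  have hd' : ∀ y : Fin n → F, (∀ j ∈ insert k K, y j = 0) →
      (s k ⬝ᵥ y) ^ 2 = ∑ j, d j * diffSq s j y := fun y hy =>
    hd y fun j hj => hy j (Finset.mem_insert_of_mem hj)
  have hdK' : ∀ j ∈ insert k K, d j = 0 := by
    simpa [hdk] using hdK
  intro i hi
  rcases Finset.mem_insert.mp hi with rfl | hi
  · exact ⟨d, hdK', hd'⟩
  · obtain ⟨c, hcK, hc⟩ := hK i hi
    refine ⟨fun j => (if j = k then 0 else c j) - c k * d j, ?_, fun y hy => ?_⟩
    · intro j hj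
      rcases Finset.mem_insert.mp hj with rfl | hj
      · simp [hdk]
      · simp [hdK j hj, hcK j hj]
    · have h1 := hd' y hy
      have hyk : y k = 0 := hy k (Finset.mem_insert_self _ _)
      rw [hc y fun j hj => hy j (Finset.mem_insert_of_mem hj)]
      simp only [sub_mul, Finset.sum_sub_distrib, mul_assoc, ← Finset.mul_sum, ← h1]
      rw [Finset.sum_eq_add_sum_sdiff_singleton_of_mem (Finset.mem_univ k),
        Finset.sum_eq_add_sum_sdiff_singleton_of_mem (Finset.mem_univ k)
          (fun j => (if j = k then 0 else c j) * diffSq s j y)]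
      rw [Finset.sum_congr rfl (g := fun j => c j * diffSq s j y)
        (f := fun j => (if j = k then 0 else c j) * diffSq s j y)]
      · simp only [if_true, zero_mul]
        rw [diffSq, hyk]
        ring
      · intro j hj
        simp only [Finset.mem_sdiff, Finset.mem_univ, Finset.mem_singleton, true_and] at hj
        simp [hj]

/-- A chain of linear forms, each of square zero modulo the previous ones, is supported on an
adapted set of variables which is no larger than the chain is long. -/
theorem exists_adapted_support (h2 : (2 : F) ≠ 0) {s : Matrix (Fin n) (Fin n) F}
    (hs : ∀ i j, i ≤ j → s i j = 0) (b : ℕ → Fin n → F) (m : ℕ)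
    (hb : ∀ i < m, ∃ c : Fin n → F, ∀ y : Fin n → F, (∀ l < i, b l ⬝ᵥ y = 0) →
      (b i ⬝ᵥ y) ^ 2 = ∑ j, c j * diffSq s j y) :
    ∃ K : Finset (Fin n), K.card ≤ m ∧ Adapted s K ∧ ∀ i < m, ∀ j ∉ K, b i j = 0 := by
  induction m with
  | zero => exact ⟨∅, by simp, by simp [Adapted], by simp⟩
  | succ m ih =>
    obtain ⟨K, hcard, hK, hsupp⟩ := ih fun i hi => hb i (hi.trans m.lt_succ_self)
    obtain ⟨c, hc⟩ := hb m m.lt_succ_self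
    have hrel : SqRel s K (b m) := hK.sqRel (c := c) fun y hy => hc y fun l hl =>
      Finset.sum_eq_zero fun j _ => by
        by_cases hj : j ∈ K
        · rw [hy j hj, mul_zero]
        · rw [hsupp l hl j hj, zero_mul]
    rcases hrel.support h2 hs with h0 | ⟨k, hk, hk', d, hdK, hdk, hd⟩
    · refine ⟨K, hcard.trans m.le_succ, hK, fun i hi => ?_⟩
      rcases Nat.lt_succ_iff_lt_or_eq.mp hi with hi | rfl
      · exact hsupp i hi
      · exact h0
    · refine ⟨insert k K, (Finset.card_insert_le _ _).trans (Nat.succ_le_succ hcard),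
        adapted_insert hK hdK hdk hd, fun i hi j hj => ?_⟩
      rw [Finset.mem_insert, not_or] at hj
      rcases Nat.lt_succ_iff_lt_or_eq.mp hi with hi | rfl
      · exact hsupp i hi j hj.2
      · exact hk' j hj.2 hj.1

/-- The matrix whose `j`-th row is the indicator of the first `f j` indices. -/
def staircase (F : Type*) [Field F] (f : Fin n → ℕ) : Matrix (Fin n) (Fin n) F :=
  Matrix.of fun j i => if (i : ℕ) < f j then 1 else 0

theorem staircase_eq_zero {f : Fin n → ℕ} (hf : ∀ j, f j ≤ j) (i j : Fin n) (hij : i ≤ j) :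
    staircase F f i j = 0 := by
  have := hf i
  have : (i : ℕ) ≤ j := hij
  simp only [staircase, of_apply, ite_eq_right_iff]
  omega

/-- Row `k` has `f k` nonzero entries, of which at most one lies outside `K`. -/
theorem le_card_add_one_of_sqRel (h2 : (2 : F) ≠ 0) {f : Fin n → ℕ} (hf : ∀ j, f j ≤ j)
    {K : Finset (Fin n)} {k : Fin n} (h : SqRel (staircase F f) K (staircase F f k)) :
    f k ≤ K.card + 1 := by
  obtain ⟨k', hk'⟩ : ∃ k', ∀ i ∉ K, i ≠ k' → staircase F f k i = 0 := by
    rcases h.support h2 (staircase_eq_zero hf) with h0 | ⟨k', -, hk', -⟩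
    · exact ⟨k, fun i hi _ => h0 i hi⟩
    · exact ⟨k', hk'⟩
  have hsub : (Finset.univ.filter fun i : Fin n => (i : ℕ) < f k) ⊆ insert k' K := by
    intro i hi
    simp only [Finset.mem_filter, Finset.mem_univ, true_and] at hi
    by_contra hcon
    rw [Finset.mem_insert, not_or] at hcon
    have := hk' i hcon.2 hcon.1
    simp [staircase, hi] at this
  have hcard := (Finset.card_le_card hsub).trans (Finset.card_insert_le _ _)
  rwa [Fin.card_filter_val_lt, min_eq_right ((hf k).trans k.2.le)] at hcard

theorem support_of_adapted (h2 : (2 : F) ≠ 0) {f : Fin n → ℕ} (hf : ∀ j, f j ≤ j)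
    {K : Finset (Fin n)} (hK : Adapted (staircase F f) K) {a : Fin n → F}
    (h : SqRel (staircase F f) K a) {j : Fin n} (hj : a j ≠ 0) : f j ≤ K.card + 1 := by
  by_cases hjK : j ∈ K
  · exact le_card_add_one_of_sqRel h2 hf (hK j hjK)
  · rcases h.support h2 (staircase_eq_zero hf) with h0 | ⟨k, -, hk', d, hdK, -, hd⟩
    · exact absurd (h0 j hjK) hj
    · obtain rfl : j = k := by
        by_contra hne
        exact hj (hk' j hjK hne)
      exact le_card_add_one_of_sqRel h2 hf ⟨d, hdK, hd⟩

end QuadraticForms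

/-! ### Dyck words as staircases -/

section Combinatorics

open DyckStep

/-- For each `U` of the word, in order, `c` plus the number of `D`s preceding it. -/
def heights : List DyckStep → ℕ → List ℕ
  | [], _ => []
  | U :: w, c => c :: heights w c
  | D :: w, c => heights w (c + 1)

theorem length_heights (w : List DyckStep) (c : ℕ) : (heights w c).length = w.count U := by
  induction w generalizing c with
  | nil => rfl
  | cons x w ih => cases x <;> simp [heights, ih]

theorem le_of_mem_heights {w : List DyckStep} {c x : ℕ} (hx : x ∈ heights w c) : c ≤ x := by
  induction w generalizing c with
  | nil => simp [heights] at hx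
  | cons y w ih =>
    cases y
    · rcases List.mem_cons.mp hx with rfl | hx
      · exact le_rfl
      · exact ih hx
    · exact (Nat.le_succ c).trans (ih hx)

theorem pairwise_heights (w : List DyckStep) (c : ℕ) : (heights w c).Pairwise (· ≤ ·) := by
  induction w generalizing c with
  | nil => exact List.Pairwise.nil
  | cons y w ih =>
    cases y
    · exact List.Pairwise.cons (fun x hx => le_of_mem_heights hx) (ih c)
    · exact ih (c + 1)

/-- Equal lengths are needed because trailing `D`s leave no trace in the heights. -/
theorem heights_injective {w w' : List DyckStep} {c : ℕ} (hl : w.length = w'.length)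
    (h : heights w c = heights w' c) : w = w' := by
  induction w generalizing w' c with
  | nil => exact (List.length_eq_zero_iff.mp hl.symm).symm
  | cons x w ih =>
    cases w' with
    | nil => simp at hl
    | cons x' w' =>
      have hl' : w.length = w'.length := by simpa using hl
      cases x <;> cases x'
      · rw [ih hl' (List.cons.inj h).2]
      · have : c ∈ heights w' (c + 1) := by
          rw [show heights w' (c + 1) = c :: heights w c from h.symm]
          exact List.mem_cons_self
        exact absurd (le_of_mem_heights this) (by omega)
      · have : c ∈ heights w (c + 1) := by
          rw [show heights w (c + 1) = c :: heights w' c from h]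
          exact List.mem_cons_self
        exact absurd (le_of_mem_heights this) (by omega)
      · rw [ih hl' h]

theorem getElem_heights_le {w : List DyckStep} {c u : ℕ}
    (h : ∀ i, c + (w.take i).count D ≤ u + (w.take i).count U) (k : ℕ)
    (hk : k < (heights w c).length) : (heights w c)[k] ≤ u + k := by
  induction w generalizing c u k with
  | nil => simp [heights] at hk
  | cons x w ih =>
    cases x
    · cases k with
      | zero => simpa [heights] using h 0
      | succ k =>
        have := ih (c := c) (u := u + 1) (fun i => by
          have := h (i + 1)
          simp at this
          omega) k (by simpa [heights] using hk)
        simp only [heights, List.getElem_cons_succ]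
        omega
    · exact ih (c := c + 1) (u := u) (fun i => by
        have := h (i + 1)
        simp at this
        omega) k hk

/-- The staircase attached to a Dyck word. -/
def profile (p : DyckWord) (j : ℕ) : ℕ :=
  match j with
  | 0 => 0
  -- The shift makes every row after the first nonempty: chains only see the thresholds `m + 1 ≥ 1`,
  -- so they cannot separate the values 0 and 1.
  | j + 1 => (heights p.toList 0).getD j 0 + 1

theorem profile_le (p : DyckWord) (j : ℕ) : profile p j ≤ j := by
  cases j with
  | zero => exact le_rfl
  | succ j =>
    simp only [profile, add_le_add_iff_right]
    by_cases hj : j < (heights p.toList 0).length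
    · rw [List.getD_eq_getElem _ _ hj]
      simpa using getElem_heights_le (c := 0) (u := 0)
        (fun i => by simpa using p.count_D_le_count_U i) j hj
    · rw [List.getD_eq_default _ _ (not_lt.mp hj)]
      exact Nat.zero_le _

theorem profile_mono {p : DyckWord} {i j : ℕ} (hij : i ≤ j) (hj : j ≤ p.semilength) :
    profile p i ≤ profile p j := by
  cases i with
  | zero => exact Nat.zero_le _
  | succ i =>
    cases j with
    | zero => omega
    | succ j =>
      have hl : (heights p.toList 0).length = p.semilength := length_heights _ _
      simp only [profile, add_le_add_iff_right]
      rw [List.getD_eq_getElem _ _ (by omega), List.getD_eq_getElem _ _ (by omega)]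
      rcases (Nat.le_of_succ_le_succ hij).eq_or_lt with rfl | hlt
      · exact le_rfl
      · exact List.pairwise_iff_getElem.mp (pairwise_heights p.toList 0) i j _ _ hlt

theorem profile_injective {p q : DyckWord} (hpq : p.semilength = q.semilength)
    (h : ∀ j ≤ p.semilength, profile p j = profile q j) : p = q := by
  have hp : (heights p.toList 0).length = p.semilength := length_heights _ _
  have hq : (heights q.toList 0).length = q.semilength := length_heights _ _
  apply DyckWord.ext
  refine heights_injective (c := 0) ?_ (List.ext_getElem (by omega) fun j h1 h2 => ?_)
  · rw [← p.two_mul_semilength_eq_length, ← q.two_mul_semilength_eq_length, hpq]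
  · have := h (j + 1) (by omega)
    simp only [profile, add_left_inj] at this
    rwa [List.getD_eq_getElem _ _ h1, List.getD_eq_getElem _ _ h2] at this

/-- A monotone function on `Fin n` is determined by the sizes of its sublevel sets. -/
theorem le_of_card_sublevel {n : ℕ} {f g : Fin n → ℕ} (hf : Monotone f) (hg : Monotone g)
    (j : Fin n) (h : (Finset.univ.filter fun i => f i ≤ f j).card ≤
      (Finset.univ.filter fun i => g i ≤ f j).card) : g j ≤ f j := by
  by_contra! hlt
  have h1 : Finset.Iic j ⊆ Finset.univ.filter fun i => f i ≤ f j := fun i hi => by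
    simpa using hf (Finset.mem_Iic.mp hi)
  have h2 : (Finset.univ.filter fun i => g i ≤ f j) ⊆ Finset.Iio j := fun i hi => by
    simp only [Finset.mem_filter, Finset.mem_univ, true_and] at hi
    rw [Finset.mem_Iio]
    by_contra! hle
    exact absurd (hg hle) (by omega)
  have h3 := Finset.card_le_card h1
  have h4 := Finset.card_le_card h2
  simp only [Fin.card_Iic, Fin.card_Iio] at h3 h4
  omega

end Combinatorics

/-! ### From the quotient algebra to quadratic forms; the invariant -/

section Algebra

variable {F : Type*} [Field F] {n : ℕ}

/-- The linear polynomial with coefficient vector `a`. -/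
noncomputable def linForm (F : Type*) [Field F] (n : ℕ) :
    (Fin n → F) →ₗ[F] MvPolynomial (Fin n) F :=
  Fintype.linearCombination F MvPolynomial.X

theorem linForm_apply (a : Fin n → F) :
    linForm F n a = ∑ i, MvPolynomial.C (a i) * MvPolynomial.X i := by
  simp [linForm, Fintype.linearCombination_apply, MvPolynomial.smul_eq_C_mul]

theorem linForm_single (j : Fin n) : linForm F n (Pi.single j 1) = MvPolynomial.X j := by
  simp [linForm]

/-- The class in `A(T)` of the linear polynomial with coefficient vector `a`. -/
noncomputable def lin (T : SLTM F n) : (Fin n → F) →ₗ[F] T.NilAlgebra :=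
  (Ideal.Quotient.mkₐ F (Ideal.span (Set.range T.relator))).toLinearMap ∘ₗ linForm F n

theorem lin_apply (T : SLTM F n) (a : Fin n → F) :
    T.lin a = Ideal.Quotient.mk (Ideal.span (Set.range T.relator)) (linForm F n a) := rfl

theorem weightedHomogeneousSubmodule_two_eq_range :
    MvPolynomial.weightedHomogeneousSubmodule F (fun _ : Fin n => (2 : ℕ)) 2 =
      LinearMap.range (linForm F n) := by
  have h : MvPolynomial.weightedHomogeneousSubmodule F (fun _ : Fin n => (2 : ℕ)) 2 =
      MvPolynomial.homogeneousSubmodule (Fin n) F 1 := by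
    ext p
    simp only [MvPolynomial.mem_weightedHomogeneousSubmodule,
      MvPolynomial.mem_homogeneousSubmodule, MvPolynomial.IsHomogeneous,
      MvPolynomial.IsWeightedHomogeneous]
    refine forall_congr' fun d => forall_congr' fun _ => ?_
    simp only [Finsupp.weight_apply, Finsupp.sum, smul_eq_mul, ← Finset.sum_mul, Pi.one_apply,
      mul_one]
    omega
  rw [h, MvPolynomial.homogeneousSubmodule_one_eq_span_X, linForm,
    Fintype.range_linearCombination]

theorem component_two (T : SLTM F n) : T.component 2 = LinearMap.range T.lin := by
  rw [component, weightedHomogeneousSubmodule_two_eq_range, lin, LinearMap.range_comp]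

theorem relator_eq (T : SLTM F n) (j : Fin n) :
    T.relator j = MvPolynomial.X j ^ 2 - linForm F n (T.1 j) * MvPolynomial.X j := by
  rw [relator, linForm_apply, Finset.sum_mul, Finset.sum_filter]
  congr 1
  refine Finset.sum_congr rfl fun i _ => ?_
  split_ifs with h
  · rfl
  · simp [T.2 j i (not_lt.mp h)]

/-- Restriction of polynomials to the line spanned by `x`. -/
noncomputable def lineEval (x : Fin n → F) : MvPolynomial (Fin n) F →ₐ[F] Polynomial F :=
  MvPolynomial.aeval fun i => Polynomial.C (x i) * Polynomial.X

theorem lineEval_linForm (x a : Fin n → F) :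
    lineEval x (linForm F n a) = Polynomial.C (a ⬝ᵥ x) * Polynomial.X := by
  simp [linForm_apply, lineEval, dotProduct, Finset.sum_mul, mul_assoc, map_sum,
    Polynomial.algebraMap_eq]

theorem lineEval_relator (T : SLTM F n) (x : Fin n → F) (j : Fin n) :
    lineEval x (T.relator j) =
      Polynomial.C (x j ^ 2 - (T.1 j ⬝ᵥ x) * x j) * Polynomial.X ^ 2 := by
  rw [relator_eq, map_sub, map_mul, map_pow, lineEval_linForm]
  simp [lineEval]
  ring

theorem coeff_zero_lineEval (x : Fin n → F) (p : MvPolynomial (Fin n) F) :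
    (lineEval x p).coeff 0 = MvPolynomial.constantCoeff p := by
  rw [← Polynomial.constantCoeff_apply]
  have : (Polynomial.constantCoeff : Polynomial F →+* F).comp (lineEval x).toRingHom =
      MvPolynomial.constantCoeff := by
    ext i <;> simp [lineEval]
  exact congrArg (fun g : MvPolynomial (Fin n) F →+* F => g p) this

/-- Relators are quadratic, so the lowest term of an ideal element on a line uses only the constant
terms of its coefficients. Hence one `c` serves all lines. -/
theorem exists_lineEval_eq_of_mem (T : SLTM F n) {p : MvPolynomial (Fin n) F}
    (hp : p ∈ Ideal.span (Set.range T.relator)) :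
    ∃ (c : Fin n → F) (g : (Fin n → F) → Polynomial F), ∀ x,
      lineEval x p = Polynomial.X ^ 2 * g x ∧
      (g x).coeff 0 = ∑ j, c j * (x j ^ 2 - (T.1 j ⬝ᵥ x) * x j) := by
  obtain ⟨h, rfl⟩ := Ideal.mem_span_range_iff_exists_fun.mp hp
  refine ⟨fun j => MvPolynomial.constantCoeff (h j), fun x => ∑ j, lineEval x (h j) *
    Polynomial.C (x j ^ 2 - (T.1 j ⬝ᵥ x) * x j), fun x => ⟨?_, ?_⟩⟩
  · simp only [map_sum, map_mul, lineEval_relator, Finset.mul_sum]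
    exact Finset.sum_congr rfl fun j _ => by ring
  · simp only [Polynomial.finsetSum_coeff, Polynomial.mul_coeff_zero, coeff_zero_lineEval,
      Polynomial.coeff_C_zero]

theorem lin_injective (T : SLTM F n) : Function.Injective T.lin := by
  rw [← LinearMap.ker_eq_bot, LinearMap.ker_eq_bot']
  intro a ha
  rw [lin_apply, Ideal.Quotient.eq_zero_iff_mem] at ha
  obtain ⟨c, g, hg⟩ := T.exists_lineEval_eq_of_mem ha
  ext i
  have h := congrArg (fun p => Polynomial.coeff p 1) (hg (Pi.single i 1)).1
  rw [lineEval_linForm] at h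
  simpa [Polynomial.coeff_X_pow_mul'] using h

/-- Restriction to a line on which the forms `b l` vanish kills their ideal; then compare
coefficients of degree 2. -/
theorem exists_sq_eq_of_mem_span (T : SLTM F n) {a : Fin n → F} {b : ℕ → Fin n → F} {m : ℕ}
    (h : T.lin a ^ 2 ∈ Ideal.span ((fun i => T.lin (b i)) '' Set.Iio m)) :
    ∃ c : Fin n → F, ∀ x : Fin n → F, (∀ l < m, b l ⬝ᵥ x = 0) →
      (a ⬝ᵥ x) ^ 2 = ∑ j, c j * (x j ^ 2 - (T.1 j ⬝ᵥ x) * x j) := by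
  have himg : (fun i => T.lin (b i)) '' Set.Iio m =
      Ideal.Quotient.mk (Ideal.span (Set.range T.relator)) ''
        ((fun i => linForm F n (b i)) '' Set.Iio m) := by
    rw [Set.image_image]
    rfl
  rw [himg, ← Ideal.map_span, lin_apply, ← map_pow, Ideal.mem_quotient_iff_mem_sup] at h
  obtain ⟨u, hu, r, hr, hur⟩ := Submodule.mem_sup.mp h
  obtain ⟨c, g, hg⟩ := T.exists_lineEval_eq_of_mem hr
  refine ⟨c, fun x hx => ?_⟩
  have hu0 : lineEval x u = 0 := by
    have hle : Ideal.span ((fun i => linForm F n (b i)) '' Set.Iio m) ≤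
        RingHom.ker (lineEval x) := by
      rw [Ideal.span_le]
      rintro _ ⟨l, hl, rfl⟩
      simp [RingHom.mem_ker, lineEval_linForm, hx l hl]
    exact hle hu
  have h1 := congrArg (fun p => Polynomial.coeff (lineEval x p) 2) hur
  simp only [map_add, hu0, zero_add, map_pow, lineEval_linForm, (hg x).1, mul_pow] at h1
  rw [← map_pow Polynomial.C, Polynomial.coeff_C_mul] at h1
  rw [← (hg x).2]
  simpa [Polynomial.coeff_X_pow_mul', Polynomial.coeff_X_pow] using h1.symm

/-- The number `d` of linearly independent elements of degree `2` which have square zero modulo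
some chain of `m` elements of degree `2`, each of square zero modulo the previous ones. -/
def HasChain (T : SLTM F n) (m d : ℕ) : Prop :=
  ∃ v : ℕ → T.NilAlgebra,
    (∀ i < m, v i ∈ T.component 2 ∧ v i ^ 2 ∈ Ideal.span (v '' Set.Iio i)) ∧
    ∃ w : Fin d → T.NilAlgebra, LinearIndependent F w ∧
      ∀ k, w k ∈ T.component 2 ∧ w k ^ 2 ∈ Ideal.span (v '' Set.Iio m)

theorem Equivalent.hasChain {T S : SLTM F n} (h : T.Equivalent S) {m d : ℕ}
    (hT : T.HasChain m d) : S.HasChain m d := by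
  obtain ⟨e, he⟩ := h
  obtain ⟨v, hv, w, hw, hwv⟩ := hT
  have hmap : ∀ i x, x ^ 2 ∈ Ideal.span (v '' Set.Iio i) →
      e x ^ 2 ∈ Ideal.span ((fun l => e (v l)) '' Set.Iio i) := by
    intro i x hx
    have := Ideal.mem_map_of_mem e hx
    rwa [Ideal.map_span, Set.image_image, map_pow] at this
  refine ⟨fun i => e (v i), fun i hi => ⟨(he 2 _).mpr (hv i hi).1, hmap i _ (hv i hi).2⟩,
    fun k => e (w k), ?_, fun k => ⟨(he 2 _).mpr (hwv k).1, hmap m _ (hwv k).2⟩⟩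
  exact hw.map' e.toLinearMap (LinearMap.ker_eq_bot.mpr e.injective)

end Algebra

/-! ### Staircase algebras and their chain invariant -/

section Staircase

variable {F : Type*} [Field F] {n : ℕ}

theorem blockTriangular_one_add {s : Matrix (Fin n) (Fin n) F}
    (hs : ∀ i j, i ≤ j → s i j = 0) : (1 + s).BlockTriangular OrderDual.toDual := by
  intro i j hij
  have hij' : i < j := hij
  simp [hs i j hij'.le, hij'.ne]

theorem isUnit_det_one_add {s : Matrix (Fin n) (Fin n) F}
    (hs : ∀ i j, i ≤ j → s i j = 0) : IsUnit (1 + s).det := by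
  rw [Matrix.det_of_isLowerTriangular _ (blockTriangular_one_add hs)]
  simp [hs]

/-- The matrix `T = 2 s (1 + s)⁻¹`: in the coordinates `Y = (1 + s)⁻¹ X` the relations of `A(T)`
become `Y_j ^ 2 = (∑ i, s_{ji} Y_i) ^ 2`. -/
noncomputable def ofSquares (s : Matrix (Fin n) (Fin n) F) (hs : ∀ i j, i ≤ j → s i j = 0) :
    SLTM F n :=
  ⟨(2 : F) • (s * (1 + s)⁻¹), fun i j hij => by
    have := Matrix.invertibleOfIsUnitDet _ (isUnit_det_one_add hs)
    have htri := Matrix.blockTriangular_inv_of_blockTriangular (blockTriangular_one_add hs)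
    rw [Matrix.smul_apply, Matrix.mul_apply, Finset.sum_eq_zero, smul_zero]
    intro k _
    rcases le_or_gt i k with hik | hki
    · rw [hs i k hik, zero_mul]
    · rw [htri (show OrderDual.toDual j < OrderDual.toDual k from hki.trans_le hij), mul_zero]⟩

/-- The linear form of `A(T)` with coefficient vector `a` in the coordinates `Y`. -/
noncomputable def sqLin (s : Matrix (Fin n) (Fin n) F) (hs : ∀ i j, i ≤ j → s i j = 0) :
    (Fin n → F) →ₗ[F] (ofSquares s hs).NilAlgebra :=
  (ofSquares s hs).lin ∘ₗ Matrix.vecMulLinear (1 + s)⁻¹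

theorem sqLin_apply (s : Matrix (Fin n) (Fin n) F) (hs : ∀ i j, i ≤ j → s i j = 0)
    (a : Fin n → F) : sqLin s hs a = (ofSquares s hs).lin (a ᵥ* (1 + s)⁻¹) := rfl

theorem sqLin_injective (s : Matrix (Fin n) (Fin n) F) (hs : ∀ i j, i ≤ j → s i j = 0) :
    Function.Injective (sqLin s hs) := by
  refine (lin_injective _).comp fun a b hab => ?_
  have h : (a ᵥ* (1 + s)⁻¹) ᵥ* (1 + s) = (b ᵥ* (1 + s)⁻¹) ᵥ* (1 + s) :=
    congrArg (fun z => z ᵥ* (1 + s)) hab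
  simpa only [vecMul_vecMul, Matrix.nonsing_inv_mul _ (isUnit_det_one_add hs), vecMul_one] using h

theorem mem_component_two_iff (s : Matrix (Fin n) (Fin n) F) (hs : ∀ i j, i ≤ j → s i j = 0)
    (x : (ofSquares s hs).NilAlgebra) :
    x ∈ (ofSquares s hs).component 2 ↔ ∃ a, sqLin s hs a = x := by
  rw [component_two, LinearMap.mem_range]
  constructor
  · rintro ⟨a, rfl⟩
    refine ⟨a ᵥ* (1 + s), ?_⟩
    rw [sqLin_apply, vecMul_vecMul, Matrix.mul_nonsing_inv _ (isUnit_det_one_add hs), vecMul_one]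
  · rintro ⟨a, rfl⟩
    exact ⟨_, rfl⟩

theorem lin_single_sq (T : SLTM F n) (j : Fin n) :
    T.lin (Pi.single j 1) ^ 2 = T.lin (T.1 j) * T.lin (Pi.single j 1) := by
  have h : Ideal.Quotient.mk (Ideal.span (Set.range T.relator)) (T.relator j) = 0 :=
    Ideal.Quotient.eq_zero_iff_mem.mpr (Ideal.subset_span ⟨j, rfl⟩)
  rw [relator_eq, map_sub, map_mul, map_pow, ← linForm_single] at h
  exact sub_eq_zero.mp h

theorem ofSquares_row (s : Matrix (Fin n) (Fin n) F) (hs : ∀ i j, i ≤ j → s i j = 0)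
    (j : Fin n) : (ofSquares s hs).1 j = (2 : F) • (s j ᵥ* (1 + s)⁻¹) := by
  ext i
  simp [ofSquares, Matrix.mul_apply, vecMul, dotProduct]

theorem lin_ofSquares_single (s : Matrix (Fin n) (Fin n) F) (hs : ∀ i j, i ≤ j → s i j = 0)
    (j : Fin n) : (ofSquares s hs).lin (Pi.single j 1) =
      sqLin s hs (Pi.single j 1) + sqLin s hs (s j) := by
  have h : Pi.single j 1 + s j = (Pi.single j 1 : Fin n → F) ᵥ* (1 + s) := by
    rw [vecMul_add, vecMul_one, single_one_vecMul]
    rfl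
  rw [← map_add, sqLin_apply, h, vecMul_vecMul,
    Matrix.mul_nonsing_inv _ (isUnit_det_one_add hs), vecMul_one]

theorem sq_eq_sq_of_add_sq_eq {R : Type*} [CommRing R] {x y z : R}
    (h : (x + y) ^ 2 = z * (x + y)) (hz : z = y + y) : x ^ 2 = y ^ 2 := by
  rw [hz] at h
  linear_combination h

theorem sqLin_single_sq (s : Matrix (Fin n) (Fin n) F) (hs : ∀ i j, i ≤ j → s i j = 0)
    (j : Fin n) : sqLin s hs (Pi.single j 1) ^ 2 = sqLin s hs (s j) ^ 2 := by
  have h := lin_single_sq (ofSquares s hs) j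
  rw [lin_ofSquares_single] at h
  refine sq_eq_sq_of_add_sq_eq h ?_
  rw [ofSquares_row, map_smul, sqLin_apply, two_smul]

theorem exists_sq_eq_sum_diffSq (s : Matrix (Fin n) (Fin n) F) (hs : ∀ i j, i ≤ j → s i j = 0)
    {a : Fin n → F} {b : ℕ → Fin n → F} {m : ℕ}
    (h : sqLin s hs a ^ 2 ∈ Ideal.span ((fun i => sqLin s hs (b i)) '' Set.Iio m)) :
    ∃ c : Fin n → F, ∀ y : Fin n → F, (∀ l < m, b l ⬝ᵥ y = 0) →
      (a ⬝ᵥ y) ^ 2 = ∑ j, c j * diffSq s j y := by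
  obtain ⟨c, hc⟩ := exists_sq_eq_of_mem_span (ofSquares s hs) (a := a ᵥ* (1 + s)⁻¹)
    (b := fun i => b i ᵥ* (1 + s)⁻¹) h
  have hinv := Matrix.nonsing_inv_mul _ (isUnit_det_one_add hs)
  have hdot : ∀ z y : Fin n → F, (z ᵥ* (1 + s)⁻¹) ⬝ᵥ ((1 + s) *ᵥ y) = z ⬝ᵥ y := fun z y => by
    rw [← dotProduct_mulVec, mulVec_mulVec, hinv, one_mulVec]
  refine ⟨c, fun y hy => ?_⟩
  have h1 := hc ((1 + s) *ᵥ y) fun l hl => by rw [hdot, hy l hl]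
  rw [hdot] at h1
  rw [h1]
  refine Finset.sum_congr rfl fun j _ => ?_
  have h2 : (ofSquares s hs).1 j ⬝ᵥ ((1 + s) *ᵥ y) = 2 * (s j ⬝ᵥ y) := by
    rw [ofSquares_row, smul_dotProduct, hdot, smul_eq_mul]
  have h3 : ((1 + s) *ᵥ y) j = y j + s j ⬝ᵥ y := by
    rw [add_mulVec, one_mulVec]
    rfl
  rw [h2, h3, diffSq]
  ring

/-- The triangular matrix attached to a staircase. -/
noncomputable abbrev ofStaircase (F : Type*) [Field F] (f : Fin n → ℕ) (hf : ∀ j, f j ≤ j) :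
    SLTM F n :=
  ofSquares (staircase F f) (staircase_eq_zero hf)

/-- The independent forms have no coordinate `j` with `f j > m + 1`, so they lie in the span of the
remaining basis vectors. -/
theorem le_of_hasChain (h2 : (2 : F) ≠ 0) {f : Fin n → ℕ} (hf : ∀ j, f j ≤ j) {m d : ℕ}
    (h : (ofStaircase F f hf).HasChain m d) :
    d ≤ (Finset.univ.filter fun j => f j ≤ m + 1).card := by
  classical
  obtain ⟨v, hv, w, hw, hwv⟩ := h
  set s := staircase F f
  have hs : ∀ i j, i ≤ j → s i j = 0 := staircase_eq_zero hf
  have hb' : ∀ i, ∃ b, i < m → sqLin s hs b = v i := fun i => by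
    by_cases hi : i < m
    · obtain ⟨b, hb⟩ := (mem_component_two_iff s hs (v i)).mp (hv i hi).1
      exact ⟨b, fun _ => hb⟩
    · exact ⟨0, fun h => absurd h hi⟩
  choose b hb using hb'
  choose a ha using fun k => (mem_component_two_iff s hs (w k)).mp (hwv k).1
  have himg : ∀ i ≤ m, v '' Set.Iio i = (fun l => sqLin s hs (b l)) '' Set.Iio i := fun i hi =>
    Set.image_congr fun l hl => (hb l (lt_of_lt_of_le hl hi)).symm
  obtain ⟨K, hcard, hK, hsupp⟩ := exists_adapted_support h2 hs b m fun i hi =>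
    exists_sq_eq_sum_diffSq s hs (by
      have := (hv i hi).2
      rwa [himg i hi.le, ← hb i hi] at this)
  have hzero : ∀ k j, m + 1 < f j → a k j = 0 := by
    intro k j hj
    by_contra hne
    have hmem := (hwv k).2
    rw [himg m le_rfl, ← ha k] at hmem
    obtain ⟨c, hc⟩ := exists_sq_eq_sum_diffSq s hs hmem
    have := support_of_adapted h2 hf hK (hK.sqRel (c := c) fun y hy => hc y fun l hl =>
      Finset.sum_eq_zero fun i _ => by
        by_cases hi : i ∈ K
        · rw [hy i hi, mul_zero]
        · rw [hsupp l hl i hi, zero_mul]) hne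
    omega
  have hind : LinearIndependent F a := by
    refine LinearIndependent.of_comp (sqLin s hs) ?_
    rwa [show sqLin s hs ∘ a = w from funext ha]
  set S := Finset.univ.filter fun j => f j ≤ m + 1
  have hle := linearIndependent_le_span' a hind
    ((S.image fun j => (Pi.single j 1 : Fin n → F) : Finset _) : Set (Fin n → F)) (by
      rintro _ ⟨k, rfl⟩
      rw [SetLike.mem_coe, pi_eq_sum_univ' (a k)]
      refine Submodule.sum_mem _ fun j _ => ?_
      by_cases hj : f j ≤ m + 1
      · refine Submodule.smul_mem _ _ (Submodule.subset_span ?_)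
        simp only [Finset.coe_image, Set.mem_image, Finset.mem_coe]
        exact ⟨j, by simp [S, hj], by ext i; simp [Pi.single_apply, eq_comm]⟩
      · rw [hzero k j (not_le.mp hj), zero_smul]
        exact Submodule.zero_mem _)
  simp only [Cardinal.mk_fin, Fintype.card_coe, Finset.coe_sort_coe, Nat.cast_le] at hle
  exact hle.trans Finset.card_image_le

theorem sqLin_staircase {f : Fin n → ℕ} (hf : ∀ j, f j ≤ j) (j : Fin n) :
    sqLin (staircase F f) (staircase_eq_zero hf) (staircase F f j) =
      ∑ i : Fin n with i.val < f j, sqLin (staircase F f) (staircase_eq_zero hf) (Pi.single i 1) := by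
  have : staircase F f j = ∑ i : Fin n with i.val < f j, Pi.single i 1 := by
    ext i
    simp [staircase, Finset.sum_apply, Pi.single_apply, Finset.sum_ite_eq]
  rw [← map_sum, ← this]

theorem hasChain_ofStaircase {f : Fin n → ℕ} (hf : ∀ j, f j ≤ j) (m : ℕ) :
    (ofStaircase F f hf).HasChain m (Finset.univ.filter fun j => f j ≤ m + 1).card := by
  let Y : Fin n → (ofStaircase F f hf).NilAlgebra := fun j =>
    sqLin (staircase F f) (staircase_eq_zero hf) (Pi.single j 1)
  -- Padding by zero covers `m > n`.
  let v : ℕ → (ofStaircase F f hf).NilAlgebra := fun i => if h : i < n then Y ⟨i, h⟩ else 0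
  have hvY : ∀ i : Fin n, v i = Y i := fun i => by simp [v]
  have hmem : ∀ (i : Fin n) (l : ℕ), (i : ℕ) < l → Y i ∈ Ideal.span (v '' Set.Iio l) :=
    fun i l hi => Ideal.subset_span ⟨i, hi, hvY i⟩
  have hcomp : ∀ i, Y i ∈ (ofStaircase F f hf).component 2 := fun i =>
    (mem_component_two_iff _ _ _).mpr ⟨_, rfl⟩
  have hrow : ∀ j, Y j ^ 2 = (∑ i : Fin n with i.val < f j, Y i) ^ 2 := fun j => by
    rw [← sqLin_staircase hf j]
    exact sqLin_single_sq _ _ j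
  have hlow : ∀ (j : Fin n) (l : ℕ), f j ≤ l → Y j ^ 2 ∈ Ideal.span (v '' Set.Iio l) := by
    intro j l hj
    rw [hrow, sq]
    refine Ideal.mul_mem_left _ _ (Ideal.sum_mem _ fun i hi => hmem i l ?_)
    simp only [Finset.mem_filter, Finset.mem_univ, true_and] at hi
    omega
  refine ⟨v, fun i _ => ?_, fun k => Y ((Finset.univ.filter fun j => f j ≤ m + 1).equivFin.symm k),
    ?_, fun k => ⟨hcomp _, ?_⟩⟩
  · by_cases hi : i < n
    · rw [hvY ⟨i, hi⟩]
      exact ⟨hcomp _, hlow _ _ (hf _)⟩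
    · simp only [v, hi, dif_neg, not_false_eq_true]
      exact ⟨Submodule.zero_mem _, by simp⟩
  · have h1 : LinearIndependent F Y :=
      (Pi.linearIndependent_single_one (Fin n) F).map' (sqLin _ (staircase_eq_zero hf))
        (LinearMap.ker_eq_bot.mpr (sqLin_injective _ _))
    exact h1.comp _ (Subtype.val_injective.comp (Equiv.injective _))
  · dsimp only
    generalize (Finset.univ.filter fun j => f j ≤ m + 1).equivFin.symm k = j'
    obtain ⟨j, hj⟩ := j'
    simp only [Finset.mem_filter, Finset.mem_univ, true_and] at hj
    rcases Nat.le_succ_iff.mp hj with hj | hj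
    · exact hlow j m hj
    · have hmj : m < j := by have := hf j; omega
      have hmn : m < n := hmj.trans j.2
      have hsum : ∑ i : Fin n with i.val < f j, Y i =
          Y ⟨m, hmn⟩ + ∑ i : Fin n with i.val < m, Y i := by
        have : (Finset.univ.filter fun i : Fin n => (i : ℕ) < f j) =
            insert ⟨m, hmn⟩ (Finset.univ.filter fun i : Fin n => (i : ℕ) < m) := by
          ext i
          simp [hj, Fin.ext_iff]
          omega
        rw [this, Finset.sum_insert (by simp)]
      have hR : ∑ i : Fin n with i.val < m, Y i ∈ Ideal.span (v '' Set.Iio m) :=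
        Ideal.sum_mem _ fun i hi => hmem i m (by simpa using hi)
      -- When `f j = m + 1`, `Y_j ^ 2 = (Y_m + R) ^ 2` with `R` in the ideal, and `Y_m ^ 2` is there
      -- too because `f m ≤ m`.
      show Y j ^ 2 ∈ _
      rw [hrow, hsum, add_sq, mul_assoc, add_assoc, ← mul_assoc, sq (∑ i : Fin n with i.val < m, Y i),
        ← add_mul]
      exact Ideal.add_mem _ (hlow _ _ (hf _)) (Ideal.mul_mem_left _ _ hR)

/-- Compare sublevel counts at the threshold `f j = m + 1`, which is why `f j ≥ 1` is required. -/
theorem le_of_equivalent (h2 : (2 : F) ≠ 0) {f g : Fin n → ℕ} (hf : ∀ j, f j ≤ j)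
    (hg : ∀ j, g j ≤ j) (hfm : Monotone f) (hgm : Monotone g)
    (h : (ofStaircase F f hf).Equivalent (ofStaircase F g hg)) (j : Fin n) (hj : 1 ≤ f j) :
    g j ≤ f j := by
  refine le_of_card_sublevel hfm hgm j ?_
  obtain ⟨m, hm⟩ := Nat.exists_eq_add_of_le' hj
  rw [hm]
  exact le_of_hasChain h2 hg (h.hasChain (hasChain_ofStaircase hf m))

/-- The triangular matrix attached to a Dyck word. -/
noncomputable def ofDyckWord (F : Type*) [Field F] (n : ℕ) (p : DyckWord) : SLTM F n :=
  ofStaircase F (fun j : Fin n => profile p j) fun j => profile_le p j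

theorem eq_of_equivalent_ofDyckWord (h2 : (2 : F) ≠ 0) (hn : 1 ≤ n) {p q : DyckWord}
    (hp : p.semilength = n - 1) (hq : q.semilength = n - 1)
    (h : (ofDyckWord F n p).Equivalent (ofDyckWord F n q)) : p = q := by
  have hmono : ∀ r : DyckWord, r.semilength = n - 1 → Monotone fun j : Fin n => profile r j :=
    fun r hr i j hij => profile_mono hij (by omega)
  refine profile_injective (hp.trans hq.symm) fun j hj => ?_
  rcases j with - | j
  · rfl
  · let i : Fin n := ⟨j + 1, by omega⟩
    exact le_antisymm
      (le_of_equivalent h2 (fun _ => profile_le _ _) (fun _ => profile_le _ _)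
        (hmono q hq) (hmono p hp) h.symm i (Nat.le_add_left 1 _))
      (le_of_equivalent h2 (fun _ => profile_le _ _) (fun _ => profile_le _ _)
        (hmono p hp) (hmono q hq) h i (Nat.le_add_left 1 _))

end Staircase

end SLTM

theorem mainTheorem3 (F : Type*) [Field F] (hF : ringChar F ≠ 2) (n : ℕ) (hn : 1 ≤ n) :
    (catalan (n - 1) : ℕ∞) ≤ SLTM.numClasses F n := by
  rw [← DyckWord.card_dyckWord_semilength_eq_catalan, ← ENat.card_eq_coe_fintype_card]
  refine ENat.card_le_card_of_injective
    (f := fun p : { p : DyckWord // p.semilength = n - 1 } =>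
      (Quotient.mk (SLTM.isoSetoid F n) (SLTM.ofDyckWord F n p.1))) fun p q hpq => ?_
  exact Subtype.ext (SLTM.eq_of_equivalent_ofDyckWord (Ring.two_ne_zero hF) hn p.2 q.2
    (Quotient.exact hpq))
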